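/- Throughout, all groups are finite. A set $\mathcal M$ of maximal subgroups of a group $G$ is irredundant if its intersection is not equal to the intersection of any proper subset of $\mathcal M$ (the empty intersection being $G$). Let $\mathrm{Mindim}(G)$ be the minimal size of an irredundant set of maximal subgroups of $G$ that is not properly contained in any other irredundant set of maximal subgroups, and let $\alpha(G)$ be the minimal size of a set of maximal subgroups of $G$ whose intersection is the Frattini subgroup of $G$. Let $D_8=\langle a,b\mid a^4,b^2,abab\rangle$ be the dihedral group of order $8$, and let $X$ be the subgroup of $D_8\times D_8\times D_8$ generated by $x_1=(a,b,b)$ and $x_2=(b,ab,a)$. Put $y_1=x_1^2$, $y_2=x_2^2$, $y_3=[x_1,x_2]$, and let $$N_1=\langle y_1,y_2\rangle,\qquad N_2=\langle y_1,y_1y_2y_3\rangle,\qquad N_3=\langle y_2,y_1y_2y_3\rangle .$$ (1) $|X|=32$, and $X$ is isomorphic to the quotient of the free group $F$ of rank $2$ by the intersection of all normal subgroups $K$ of $F$ with $F/K\cong D_8$. Each $N_i$ is a normal subgroup of $X$ with $X/N_i\cong D_8$. (2) There exist irreducible $2$-dimensional $\mathbb F_3X$-modules $A_1,A_2,A_3$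 such that $C_X(A_i)=N_i$ for $i=1,2,3$. (3) For any such $A_1,A_2,A_3$, let $G=(A_1\times A_2\times A_3){:}X$ be the semidirect product with respect to the componentwise action. Then $G$ is a finite soluble group with $\alpha(G)\geqslant 6$ and $\mathrm{Mindim}(G)\leqslant 5$. For every positive integer $k$, the direct power $\Gamma_k=G^k$ is soluble, and $\alpha(\Gamma_k)\geqslant 6k$ and $\mathrm{Mindim}(\Gamma_k)\leqslant 5k$, so $\alpha(\Gamma_k)-\mathrm{Mindim}(\Gamma_k)\geqslant k$. (4) Consequently, for every $n$ there is a finite soluble group $H$ with $\alpha(H)-\mathrm{Mindim}(H)\geqslant n$. -/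

import Mathlib

noncomputable section

namespace SolubleExample

/-! ### Irredundant sets of maximal subgroups -/

/-- A set `M` of maximal subgroups of `G` whose intersection differs from the intersection of
every proper subset of `M` (the empty intersection is `G`). -/
def IsIrredundant {G : Type*} [Group G] (M : Set (Subgroup G)) : Prop :=
  (∀ H ∈ M, IsCoatom H) ∧ ∀ T : Set (Subgroup G), T ⊂ M → sInf T ≠ sInf M

/-- An irredundant set of maximal subgroups that is not properly contained in any other
irredundant set of maximal subgroups. -/
def IsMaximalIrredundant {G : Type*} [Group G] (M : Set (Subgroup G)) : Prop :=
  Maximal IsIrredundant M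

/-- The minimal dimension of a finite group: the minimal size of a maximal irredundant set of
maximal subgroups. -/
def Mindim (G : Type*) [Group G] : ℕ :=
  sInf {n | ∃ M : Set (Subgroup G), IsMaximalIrredundant M ∧ M.ncard = n}

/-- The invariant `α(G)` of a finite group: the minimal size of a set of maximal subgroups of `G`
whose intersection is the Frattini subgroup. -/
def alpha (G : Type*) [Group G] : ℕ :=
  sInf {n | ∃ T : Set (Subgroup G), (∀ H ∈ T, IsCoatom H) ∧ sInf T = frattini G ∧ T.ncard = n}

/-- For a finite group the minimum that defines `Mindim` is over a nonempty set. -/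
theorem exists_ncard_eq_Mindim (G : Type*) [Group G] [Finite G] :
    ∃ M : Set (Subgroup G), IsMaximalIrredundant M ∧ M.ncard = Mindim G := by
  have hne : {n | ∃ M : Set (Subgroup G), IsMaximalIrredundant M ∧ M.ncard = n}.Nonempty := by
    have h0 : IsIrredundant (∅ : Set (Subgroup G)) :=
      ⟨fun H hH => absurd hH (Set.notMem_empty H),
        fun T hT => absurd (Set.empty_subset T) hT.2⟩
    obtain ⟨M, -, hM⟩ := Finite.exists_le_maximal h0
    exact ⟨M.ncard, M, hM, rfl⟩
  exact Nat.sInf_mem hne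

/-- For a finite group the minimum that defines `alpha` is over a nonempty set. -/
theorem exists_ncard_eq_alpha (G : Type*) [Group G] :
    ∃ T : Set (Subgroup G), (∀ H ∈ T, IsCoatom H) ∧ sInf T = frattini G ∧
      T.ncard = alpha G := by
  have hne : {n | ∃ T : Set (Subgroup G), (∀ H ∈ T, IsCoatom H) ∧ sInf T = frattini G ∧
      T.ncard = n}.Nonempty :=
    ⟨_, {H | IsCoatom H}, fun _ h => h, by rw [frattini, Order.radical, sInf_eq_iInf], rfl⟩
  exact Nat.sInf_mem hne

/-! ### The group `X` of order 32 -/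

/-- The dihedral group of order 8. -/
abbrev D8 : Type := DihedralGroup 4

/-- The rotation of order 4 in `D8`. -/
def a : D8 := DihedralGroup.r 1

/-- A reflection in `D8`. -/
def b : D8 := DihedralGroup.sr 0

/-- The subgroup of `D8 × D8 × D8` generated by `(a, b, b)` and `(b, ab, a)`. -/
def X : Subgroup (D8 × D8 × D8) :=
  Subgroup.closure {(a, b, b), (b, a * b, a)}

/-- The first generator `(a, b, b)` of `X`. -/
def x₁ : X := ⟨(a, b, b), Subgroup.subset_closure (by simp)⟩

/-- The second generator `(b, ab, a)` of `X`. -/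
def x₂ : X := ⟨(b, a * b, a), Subgroup.subset_closure (by simp)⟩

/-- `y₁ = x₁² = (a², 1, 1)`. -/
def y₁ : X := x₁ ^ 2

/-- `y₂ = x₂² = (1, 1, a²)`. -/
def y₂ : X := x₂ ^ 2

/-- `y₃ = [x₁, x₂] = (a², a², a²)`. -/
def y₃ : X := x₁⁻¹ * x₂⁻¹ * x₁ * x₂

/-- The three normal subgroups `⟨y₁, y₂⟩`, `⟨y₁, y₁y₂y₃⟩`, `⟨y₂, y₁y₂y₃⟩` of `X`. -/
def N : Fin 3 → Subgroup X :=
  ![Subgroup.closure {y₁, y₂}, Subgroup.closure {y₁, y₁ * y₂ * y₃},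
    Subgroup.closure {y₂, y₁ * y₂ * y₃}]

/-- The intersection of all normal subgroups of the free group of rank 2 with quotient
isomorphic to `D8`. -/
def freeKernel : Subgroup (FreeGroup (Fin 2)) :=
  sInf {K | ∃ _ : K.Normal, Nonempty (FreeGroup (Fin 2) ⧸ K ≃* D8)}

instance freeKernel_normal : freeKernel.Normal := by
  constructor
  intro n hn g
  rw [freeKernel, Subgroup.mem_sInf] at hn ⊢
  rintro K ⟨hK, e⟩
  exact hK.conj_mem n (hn K ⟨hK, e⟩) g

/-! ### The semidirect product `(A₁ × A₂ × A₃) : X` -/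

/-- The componentwise action by automorphisms of `X` on the direct product of the additive groups
of three `X`-modules, written multiplicatively. -/
def action {A : Fin 3 → Type*} [∀ i, AddCommGroup (A i)] [∀ i, Module (ZMod 3) (A i)]
    (ρ : ∀ i, Representation (ZMod 3) X (A i)) :
    X →* MulAut (Multiplicative (∀ i, A i)) where
  toFun x := AddEquiv.toMultiplicative
    { toFun := fun v i => ρ i x (v i)
      invFun := fun v i => ρ i x⁻¹ (v i)
      left_inv := fun v => by funext i; simp
      right_inv := fun v => by funext i; simp
      map_add' := fun v w => by funext i; simp }
  map_one' := by
    refine MulEquiv.ext fun v => ?_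
    apply Multiplicative.toAdd.injective
    funext i
    change ρ i 1 (v.toAdd i) = v.toAdd i
    simp
  map_mul' x y := by
    refine MulEquiv.ext fun v => ?_
    apply Multiplicative.toAdd.injective
    funext i
    change ρ i (x * y) (v.toAdd i) = ρ i x (ρ i y (v.toAdd i))
    simp

/-- The semidirect product `(A₁ × A₂ × A₃) : X`. -/
abbrev SemiProd {A : Fin 3 → Type*} [∀ i, AddCommGroup (A i)] [∀ i, Module (ZMod 3) (A i)]
    (ρ : ∀ i, Representation (ZMod 3) X (A i)) : Type _ :=
  Multiplicative (∀ i, A i) ⋊[action ρ] X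

/-- The data of the three modules: every `A i` is an irreducible 2-dimensional `X`-module over
the field with three elements, and `C_X(A i) = N i`. -/
def IsModuleTriple {A : Fin 3 → Type*} [∀ i, AddCommGroup (A i)] [∀ i, Module (ZMod 3) (A i)]
    (ρ : ∀ i, Representation (ZMod 3) X (A i)) : Prop :=
  ∀ i, (ρ i).IsIrreducible ∧ Module.finrank (ZMod 3) (A i) = 2 ∧ MonoidHom.ker (ρ i) = N i

end SolubleExample

end

/-!
Let `zᵢ` be the central involution of `X` that inverts the module `Aᵢ` and centralizes the other
two. Each `zᵢ` is a square, and modulo `Aᵢ` it is central in `G`, so it lies in every maximal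
subgroup that contains `Aᵢ`.

For the bound on `α`, a maximal subgroup contains all but at most one of the `Aᵢ`. If at most one
member of a family of maximal subgroups with intersection `Φ(G)` missed `Aᵢ`, then some `zᵢu` with
`u ∈ Aᵢ` would lie in `Φ(G)`. Since `Φ(G)` is normal and contained in the maximal subgroup
`C_G(zᵢ)`, the commutator of `zᵢu` with any element of `Aᵢ` would then commute with `zᵢ`, hence be
trivial. So every `Aᵢ` is missed at least twice.

For the bound on `Mindim`, take the complements `C_G(zᵢ)` together with two subgroups of index two
whose intersection is generated by all `Aᵢ` and `zᵢ`. A maximal subgroup `K` that can be added to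
this irredundant set must miss some `Aᵢ`, hence contains some `zᵢu` with `u ∈ Aᵢ`. The elements that
witness irredundance at the two subgroups of index two centralize `zᵢ` and lie in `K`, hence they
centralize `u`, and `⟨u⟩` is normal in `G`. As `Aᵢ` is not cyclic, `u = 1`, so `zᵢ ∈ K` and
`K = C_G(zᵢ)`.

These arguments use only the behaviour of the pairs `(Aᵢ, zᵢ)` and the subgroups of index two, which
passes to direct products.
-/

noncomputable section

namespace SolubleExample

open scoped commutatorElement

section MinimalNormal

variable {G : Type*} [Group G] {V W K : Subgroup G}

theorem exists_mul_mem_of_isCoatom [V.Normal] (hK : IsCoatom K) (hVK : ¬ V ≤ K) (g : G) :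
    ∃ v ∈ V, g * v ∈ K := by
  obtain ⟨k, hk, v, hv, hkv⟩ :=
    Subgroup.mem_sup_of_normal_right.1 (hK.2 _ (left_lt_sup.2 hVK) ▸ Subgroup.mem_top g)
  exact ⟨v⁻¹, inv_mem hv, by rwa [← hkv, mul_inv_cancel_right]⟩

/-- A minimal normal subgroup: a nontrivial normal subgroup that contains no smaller one. -/
def IsMinimalNormal (V : Subgroup G) : Prop :=
  Minimal (fun W : Subgroup G => W.Normal ∧ W ≠ ⊥) V

namespace IsMinimalNormal

theorem normal (hV : IsMinimalNormal V) : V.Normal := hV.prop.1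

theorem ne_bot (hV : IsMinimalNormal V) : V ≠ ⊥ := hV.prop.2

theorem disjoint_or_le (hV : IsMinimalNormal V) (hn : (K ⊓ V).Normal) :
    Disjoint K V ∨ V ≤ K := by
  by_cases hbot : K ⊓ V = ⊥
  · exact Or.inl (disjoint_iff.2 hbot)
  · exact Or.inr ((hV.2 ⟨hn, hbot⟩ inf_le_right).trans inf_le_left)

theorem disjoint (hV : IsMinimalNormal V) (hW : IsMinimalNormal W) (hne : V ≠ W) :
    Disjoint V W := by
  have := hV.normal
  have := hW.normal
  refine (hW.disjoint_or_le inferInstance).resolve_right fun hle => hne ?_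
  exact hV.eq_of_ge hW.prop hle

theorem commute (hV : IsMinimalNormal V) (hW : IsMinimalNormal W) (hne : V ≠ W) {v w : G}
    (hv : v ∈ V) (hw : w ∈ W) : Commute v w :=
  Subgroup.commute_of_normal_of_disjoint V W hV.normal hW.normal (hV.disjoint hW hne) v w hv hw

theorem disjoint_or_le_of_sup_eq_top [IsMulCommutative V] (hV : IsMinimalNormal V)
    (hK : K ⊔ V = ⊤) : Disjoint K V ∨ V ≤ K := by
  have := hV.normal
  refine hV.disjoint_or_le ⟨fun x hx g => ?_⟩
  obtain ⟨hxK, hxV⟩ := Subgroup.mem_inf.1 hx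
  obtain ⟨k, hk, v, hv, rfl⟩ := Subgroup.mem_sup_of_normal_right.1 (hK ▸ Subgroup.mem_top g)
  have hconj : k * v * x * (k * v)⁻¹ = k * x * k⁻¹ := by
    rw [mul_assoc k, setLike_mul_comm hv hxV]
    group
  exact Subgroup.mem_inf.2
    ⟨hconj ▸ mul_mem (mul_mem hk hxK) (inv_mem hk), this.conj_mem x hxV _⟩

theorem isCompl_of_isCoatom [IsMulCommutative V] (hV : IsMinimalNormal V) (hK : IsCoatom K)
    (hVK : ¬ V ≤ K) : IsCompl K V := by
  have hsup : K ⊔ V = ⊤ := hK.2 _ (left_lt_sup.2 hVK)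
  exact ⟨(hV.disjoint_or_le_of_sup_eq_top hsup).resolve_right hVK, codisjoint_iff.2 hsup⟩

theorem commute_of_commutator_mem [IsMulCommutative V] (hV : IsMinimalNormal V) (hK : IsCoatom K)
    (hVK : ¬ V ≤ K) {x y : G} (hx : x ∈ K) (hy : y ∈ K) (hxy : ⁅x, y⁆ ∈ V) : Commute x y :=
  commutatorElement_eq_one_iff_commute.1 (Subgroup.disjoint_def.1
    (hV.isCompl_of_isCoatom hK hVK).disjoint
    (mul_mem (mul_mem (mul_mem hx hy) (inv_mem hx)) (inv_mem hy)) hxy)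

theorem isCoatom_of_isCompl [IsMulCommutative V] (hV : IsMinimalNormal V) (hKV : IsCompl K V) :
    IsCoatom K := by
  have := hV.normal
  refine ⟨fun hK => hV.ne_bot (disjoint_self.1 (hKV.disjoint.mono_left (hK ▸ le_top))),
    fun H hKH => ?_⟩
  have hsup : H ⊔ V = ⊤ := top_unique (hKV.sup_eq_top ▸ sup_le_sup_right hKH.le V)
  rcases hV.disjoint_or_le_of_sup_eq_top hsup with hdisj | hVH
  · refine absurd (fun h hh => ?_) hKH.not_ge
    obtain ⟨k, hk, v, hv, rfl⟩ :=
      Subgroup.mem_sup_of_normal_right.1 (hKV.sup_eq_top ▸ Subgroup.mem_top h)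
    have hvH : v ∈ H := (Subgroup.mul_mem_cancel_left H (hKH.le hk)).1 hh
    rwa [Subgroup.disjoint_def.1 hdisj hvH hv, mul_one]
  · exact top_unique (hKV.sup_eq_top ▸ sup_le hKH.le hVH)

end IsMinimalNormal

end MinimalNormal

section InvertingSquare

variable {G : Type*} [Group G] {V W K : Subgroup G} {z : G}

/-- `V` is a noncentral abelian chief factor at the bottom of `G`, and `z` is a square of order
at most two that is central modulo `V` but does not centralize `V`. It follows that `z` inverts `V`
and that its centralizer is a maximal subgroup complementing `V`. -/
structure IsInvertingSquare (V : Subgroup G) (z : G) : Prop where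
  isMinimalNormal : IsMinimalNormal V
  isMulCommutative : IsMulCommutative V
  commutator_mem : ∀ g, ⁅z, g⁆ ∈ V
  isSquare : IsSquare z
  sq_eq_one : z ^ 2 = 1
  exists_not_commute : ∃ v ∈ V, ¬ Commute z v

namespace IsInvertingSquare

theorem eq_one_of_commute (h : IsInvertingSquare V z) {v : G} (hv : v ∈ V) (hzv : Commute z v) :
    v = 1 := by
  have := h.isMulCommutative
  have hn := h.isMinimalNormal.normal
  have hnormal : (Subgroup.centralizer {z} ⊓ V).Normal := by
    refine ⟨fun x hx g => ?_⟩
    rw [Subgroup.mem_inf, Subgroup.mem_centralizer_singleton_iff] at hx ⊢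
    have hconj : Commute (⁅z, g⁻¹⁆⁻¹ * z) x :=
      .mul_left (setLike_mul_comm (inv_mem (h.commutator_mem g⁻¹)) hx.2) hx.1.symm
    rw [← Commute.conj_iff g, commutatorElement_def] at hconj
    exact ⟨by simpa [mul_assoc] using! hconj.eq.symm, hn.conj_mem x hx.2 g⟩
  have hdisj := (h.isMinimalNormal.disjoint_or_le hnormal).resolve_right fun hle =>
    let ⟨w, hw, hzw⟩ := h.exists_not_commute
    hzw (Subgroup.mem_centralizer_singleton_iff.1 (hle hw)).symm
  exact Subgroup.disjoint_def.1 hdisj (Subgroup.mem_centralizer_singleton_iff.2 hzv.symm.eq) hv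

theorem inv_eq_self (h : IsInvertingSquare V z) : z⁻¹ = z :=
  inv_eq_of_mul_eq_one_left (sq z ▸ h.sq_eq_one)

theorem conj_eq_inv (h : IsInvertingSquare V z) {v : G} (hv : v ∈ V) : z * v * z⁻¹ = v⁻¹ := by
  have := h.isMulCommutative
  have hconj : z * v * z⁻¹ ∈ V := h.isMinimalNormal.normal.conj_mem v hv z
  -- `z` swaps `v` and `z * v * z⁻¹`, hence fixes their product.
  refine eq_inv_of_mul_eq_one_left (h.eq_one_of_commute (mul_mem hconj hv) ?_)
  calc z * (z * v * z⁻¹ * v) = z * (v * (z * v * z⁻¹)) := by rw [setLike_mul_comm hconj hv]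
    _ = z * v * z * v * z⁻¹ := by group
    _ = z * v * z⁻¹ * v * z := by rw [h.inv_eq_self]

theorem exists_sq_eq [Finite V] (h : IsInvertingSquare V z) {v : G} (hv : v ∈ V) :
    ∃ u ∈ V, u ^ 2 = v := by
  have := h.isMulCommutative
  have hinj : Function.Injective fun u : V => u ^ 2 := by
    intro u w (huw : u ^ 2 = w ^ 2)
    have hsq : ((u * w⁻¹ : V) : G) * (u * w⁻¹ : V) = 1 := by
      rw [← Subgroup.coe_mul, ← sq, Commute.mul_pow (mul_comm' u w⁻¹), huw]
      simp
    refine mul_inv_eq_one.1 (Subtype.ext (h.eq_one_of_commute (SetLike.coe_mem (u * w⁻¹)) ?_))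
    refine mul_inv_eq_iff_eq_mul.1 ?_
    rw [h.conj_eq_inv (SetLike.coe_mem _), inv_eq_of_mul_eq_one_left hsq]
  obtain ⟨u, hu⟩ := Finite.surjective_of_injective hinj ⟨v, hv⟩
  exact ⟨u, u.2, congrArg Subtype.val hu⟩

theorem isCompl_centralizer [Finite V] (h : IsInvertingSquare V z) :
    IsCompl (Subgroup.centralizer {z}) V := by
  have hn := h.isMinimalNormal.normal
  refine ⟨Subgroup.disjoint_def.2 fun hz hv => h.eq_one_of_commute hv
    (Subgroup.mem_centralizer_singleton_iff.1 hz).symm, codisjoint_iff.2 (top_unique fun g _ => ?_)⟩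
  have hmem : g⁻¹ * ⁅z, g⁆ * g ∈ V := by
    simpa using hn.conj_mem _ (h.commutator_mem g) g⁻¹
  obtain ⟨u, hu, huu⟩ := h.exists_sq_eq hmem
  have hzu : z * u = u⁻¹ * z := mul_inv_eq_iff_eq_mul.1 (h.conj_eq_inv hu)
  refine Subgroup.mem_sup_of_normal_right.2 ⟨g * u, ?_, u⁻¹, inv_mem hu, by group⟩
  rw [Subgroup.mem_centralizer_singleton_iff]
  calc g * u * z = g * u ^ 2 * (u⁻¹ * z) := by group
    _ = z * (g * u) := by rw [huu, ← hzu, commutatorElement_def]; group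

theorem isCoatom_centralizer [Finite V] (h : IsInvertingSquare V z) :
    IsCoatom (Subgroup.centralizer {z}) :=
  have := h.isMulCommutative
  h.isMinimalNormal.isCoatom_of_isCompl h.isCompl_centralizer

theorem mem_of_isCoatom (h : IsInvertingSquare V z) (hK : IsCoatom K) (hVK : V ≤ K) : z ∈ K := by
  by_contra hzK
  have hz : z ∈ Subgroup.normalizer (K : Set G) := by
    refine Subgroup.mem_normalizer_iff.2 fun k => ?_
    rw [show z * k * z⁻¹ = ⁅z, k⁆ * k by rw [commutatorElement_def]; group]
    exact (Subgroup.mul_mem_cancel_left K (hVK (h.commutator_mem k))).symm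
  have : K.Normal := Subgroup.normalizer_eq_top_iff.1
    (hK.2 _ (Subgroup.le_normalizer.lt_of_not_ge fun hle => hzK (hle hz)))
  have hsup : K ⊔ Subgroup.zpowers z = ⊤ :=
    hK.2 _ (left_lt_sup.2 fun hle => hzK (hle (Subgroup.mem_zpowers z)))
  -- In `G ⧸ K`, generated by the image of `z`, every square is trivial; but `z` is a square.
  obtain ⟨s, rfl⟩ := h.isSquare
  obtain ⟨k, hk, _, ⟨n, rfl⟩, hs⟩ :=
    Subgroup.mem_sup_of_normal_left.1 (hsup ▸ Subgroup.mem_top s)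
  dsimp only at hs
  set t := (s * s) ^ n
  have htt : t * t = 1 := by
    rw [← Commute.mul_zpow (.refl _), ← sq, h.sq_eq_one, one_zpow]
  refine hzK ?_
  rw [show s * s = k * (t * k * t⁻¹) * (t * t) by rw [← hs]; group, htt, mul_one]
  exact mul_mem hk (this.conj_mem k hk t)

theorem eq_centralizer [Finite V] (h : IsInvertingSquare V z) (hK : IsCoatom K) (hVK : ¬ V ≤ K)
    (hz : z ∈ K) : K = Subgroup.centralizer {z} := by
  have := h.isMulCommutative
  refine ((hK.le_iff_eq h.isCoatom_centralizer.1).1 fun g hg => ?_).symm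
  exact Subgroup.mem_centralizer_singleton_iff.2
    (h.isMinimalNormal.commute_of_commutator_mem hK hVK hz hg (h.commutator_mem g)).symm

theorem commute_of_mul_mem (h : IsInvertingSquare V z) (hK : IsCoatom K) (hVK : ¬ V ≤ K) {u g : G}
    (hu : u ∈ V) (hzu : z * u ∈ K) (hg : g ∈ K) (hzg : Commute z g) : Commute u g := by
  have := h.isMulCommutative
  have hn := h.isMinimalNormal.normal
  have hug : ⁅u, g⁆ ∈ V := by
    rw [commutatorElement_def, mul_assoc, mul_assoc, ← mul_assoc g]
    exact mul_mem hu (hn.conj_mem _ (inv_mem hu) g)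
  have hzug : ⁅z * u, g⁆ ∈ V := by
    rw [commutatorElement_mul_left_eq_conj_mul, hzg.commutator_eq, mul_one]
    exact hn.conj_mem _ hug z
  have hcomm := h.isMinimalNormal.commute_of_commutator_mem hK hVK hzu hg hzug
  simpa using hzg.inv_left.mul_left hcomm

theorem commute_of_isMinimalNormal (h : IsInvertingSquare V z) (hW : IsMinimalNormal W)
    (hne : V ≠ W) {w : G} (hw : w ∈ W) : Commute z w := by
  have hmem : ⁅z, w⁆ ∈ W := mul_mem (hW.normal.conj_mem w hw z) (inv_mem hw)
  exact commutatorElement_eq_one_iff_commute.1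
    (Subgroup.disjoint_def.1 (h.isMinimalNormal.disjoint hW hne) (h.commutator_mem w) hmem)

theorem le_or_le_of_isCoatom (h : IsInvertingSquare V z) (hW : IsMinimalNormal W)
    [IsMulCommutative W] (hne : V ≠ W) (hK : IsCoatom K) : V ≤ K ∨ W ≤ K := by
  by_contra! hle
  obtain ⟨hVK, hWK⟩ := hle
  have := h.isMulCommutative
  have := hW.normal
  obtain ⟨v, hv, hzv⟩ := h.exists_not_commute
  obtain ⟨w, hw, hzw⟩ := exists_mul_mem_of_isCoatom hK hWK z
  obtain ⟨u, hu, hvu⟩ := exists_mul_mem_of_isCoatom hK hWK v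
  have hwvu : Commute w (v * u) :=
    .mul_right (h.isMinimalNormal.commute hW hne hv hw).symm (setLike_mul_comm hw hu)
  have hzu : Commute z u := h.commute_of_isMinimalNormal hW hne hu
  have hcomm : ⁅z * w, v * u⁆ = ⁅z, v⁆ := by
    rw [commutatorElement_mul_left_eq_conj_mul, hwvu.commutator_eq,
      commutatorElement_mul_right_eq_mul_conj, hzu.commutator_eq]
    group
  have hzwvu := h.isMinimalNormal.commute_of_commutator_mem hK hVK hzw hvu
    (hcomm ▸ h.commutator_mem v)
  exact hzv (commutatorElement_eq_one_iff_commute.1 (hcomm ▸ hzwvu.commutator_eq))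

theorem nontrivial_of_sInf_eq_frattini [Finite V] (h : IsInvertingSquare V z)
    {T : Set (Subgroup G)} (hT : ∀ K ∈ T, IsCoatom K) (hsInf : sInf T = frattini G) :
    {K ∈ T | ¬ V ≤ K}.Nontrivial := by
  rw [← Set.not_subsingleton_iff]
  intro hsub
  have hn := h.isMinimalNormal.normal
  obtain ⟨u, hu, hmem⟩ : ∃ u ∈ V, ∀ K ∈ T, ¬ V ≤ K → z * u ∈ K := by
    rcases Set.eq_empty_or_nonempty {K ∈ T | ¬ V ≤ K} with hempty | ⟨K, hKT, hVK⟩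
    · exact ⟨1, one_mem V, fun K hKT hVK => (hempty.le ⟨hKT, hVK⟩).elim⟩
    · obtain ⟨u, hu, hzu⟩ := exists_mul_mem_of_isCoatom (hT K hKT) hVK z
      exact ⟨u, hu, fun L hLT hVL => hsub ⟨hKT, hVK⟩ ⟨hLT, hVL⟩ ▸ hzu⟩
  have hfrattini : z * u ∈ frattini G := hsInf ▸ Subgroup.mem_sInf.2 fun K hKT => by
    by_cases hVK : V ≤ K
    · exact mul_mem (h.mem_of_isCoatom (hT K hKT) hVK) (hVK hu)
    · exact hmem K hKT hVK
  have hle : frattini G ≤ Subgroup.centralizer {z} := frattini_le_coatom h.isCoatom_centralizer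
  have := h.isMulCommutative
  obtain ⟨v, hv, hzv⟩ := h.exists_not_commute
  have huv : Commute u v := setLike_mul_comm hu hv
  have hcomm : ⁅z, v⁆ ∈ frattini G := by
    have hnormal : (frattini G).Normal := inferInstance
    have heq : ⁅z, v⁆ = z * u * (v * (z * u)⁻¹ * v⁻¹) := by
      rw [mul_inv_rev, ← mul_assoc v, ← huv.inv_left.eq, commutatorElement_def]
      group
    exact heq ▸ mul_mem hfrattini (hnormal.conj_mem _ (inv_mem hfrattini) v)
  refine hzv (commutatorElement_eq_one_iff_commute.1 (h.eq_one_of_commute (h.commutator_mem v) ?_))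
  exact (Subgroup.mem_centralizer_singleton_iff.1 (hle hcomm)).symm

end IsInvertingSquare

theorem two_mul_card_le_alpha [Finite G] {J : Type*} {V : J → Subgroup G} {z : J → G}
    (hinj : Function.Injective V) (h : ∀ j, IsInvertingSquare (V j) (z j)) :
    2 * Nat.card J ≤ alpha G := by
  obtain ⟨T, hT, hsInf, hcard⟩ := exists_ncard_eq_alpha G
  have := Finite.of_injective V hinj
  have := Fintype.ofFinite J
  let S (j : J) : Set (Subgroup G) := {K ∈ T | ¬ V j ≤ K}
  have hS : Function.Injective fun p : Σ j, S j => (⟨p.2, p.2.2.1⟩ : T) := by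
    rintro ⟨i, K, hKT, hi⟩ ⟨j, L, hLT, hj⟩ hKL
    obtain rfl : K = L := congrArg Subtype.val hKL
    obtain rfl : i = j := by
      by_contra hij
      have := (h j).isMulCommutative
      exact ((h i).le_or_le_of_isCoatom (h j).isMinimalNormal (hinj.ne hij) (hT K hKT)).elim hi hj
    rfl
  have htwo (j : J) : 2 ≤ Nat.card (S j) :=
    have := ((h j).nontrivial_of_sInf_eq_frattini hT hsInf).coe_sort
    Finite.one_lt_card
  calc 2 * Nat.card J = ∑ _j : J, 2 := by simp [mul_comm]
    _ ≤ ∑ j, Nat.card (S j) := Finset.sum_le_sum fun j _ => htwo j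
    _ = Nat.card (Σ j, S j) := Nat.card_sigma.symm
    _ ≤ alpha G := hcard ▸ Nat.card_le_card_of_injective _ hS

end InvertingSquare

section Irredundant

variable {G : Type*} [Group G]

theorem IsIrredundant.exists_notMem_forall_mem {S : Set (Subgroup G)} (hS : IsIrredundant S)
    {K : Subgroup G} (hK : K ∈ S) : ∃ g, g ∉ K ∧ ∀ L ∈ S, L ≠ K → g ∈ L := by
  by_contra! hc
  refine hS.2 (S \ {K}) (Set.sdiff_singleton_ssubset.2 hK)
    (le_antisymm (fun g hg => ?_) (sInf_le_sInf Set.sdiff_subset))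
  have hmem : ∀ L ∈ S, L ≠ K → g ∈ L := fun L hL hLK => Subgroup.mem_sInf.1 hg L ⟨hL, hLK⟩
  refine Subgroup.mem_sInf.2 fun L hL => (eq_or_ne L K).elim (fun hLK => ?_) (hmem L hL)
  by_contra hgL
  obtain ⟨M, hM, hMK, hgM⟩ := hc g (hLK ▸ hgL)
  exact hgM (hmem M hM hMK)

theorem isIrredundant_range {ι : Type*} {C : ι → Subgroup G} (hC : ∀ i, IsCoatom (C i))
    (hg : ∀ i, ∃ g, g ∉ C i ∧ ∀ j ≠ i, g ∈ C j) : IsIrredundant (Set.range C) := by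
  refine ⟨Set.forall_mem_range.2 hC, fun T hT heq => hT.2 ?_⟩
  rintro _ ⟨i, rfl⟩
  by_contra hiT
  obtain ⟨g, hgi, hgj⟩ := hg i
  have hmem : g ∈ sInf (Set.range C) := by
    refine heq ▸ Subgroup.mem_sInf.2 fun L hL => ?_
    obtain ⟨j, rfl⟩ := hT.1 hL
    exact hgj j fun hji => hiT (hji ▸ hL)
  exact hgi (Subgroup.mem_sInf.1 hmem _ (Set.mem_range_self i))

theorem isCoatom_of_index_eq_two {P : Subgroup G} (hP : P.index = 2) : IsCoatom P := by
  refine ⟨fun h => by simp [h] at hP, fun H hPH => ?_⟩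
  obtain ⟨x, hxH, hxP⟩ := SetLike.exists_of_lt hPH
  refine top_unique fun g _ => ?_
  by_cases hg : g ∈ P
  · exact hPH.le hg
  · have hxg : x * g ∈ P := (Subgroup.mul_mem_iff_of_index_two hP).2 (iff_of_false hxP hg)
    exact (Subgroup.mul_mem_cancel_left H hxH).1 (hPH.le hxg)

theorem eq_top_of_iInf_le_of_index_eq_two {L : Type*} [Finite L] {P : L → Subgroup G}
    {H : Subgroup G} (hP : ∀ l, (P l).index = 2) (hPH : ⨅ l, P l ≤ H)
    (hH : ∀ l, ∃ x ∈ H, ∀ m, x ∈ P m ↔ m ≠ l) : H = ⊤ := by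
  classical
  have := Fintype.ofFinite L
  choose x hxH hx using hH
  have key : ∀ (s : Finset L) (g : G), (∀ l ∉ s, g ∈ P l) → g ∈ H := fun s => by
    induction s using Finset.induction_on with
    | empty => exact fun g hg => hPH (Subgroup.mem_iInf.2 fun l => hg l (Finset.notMem_empty l))
    | insert l s _ ih =>
      intro g hg
      by_cases hgl : g ∈ P l
      · refine ih g fun m hm => ?_
        rcases eq_or_ne m l with rfl | hml
        exacts [hgl, hg m (by simp [hml, hm])]
      · refine (Subgroup.mul_mem_cancel_left H (hxH l)).1 (ih _ fun m hm => ?_)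
        rw [Subgroup.mul_mem_iff_of_index_two (hP m), hx]
        rcases eq_or_ne m l with rfl | hml
        exacts [iff_of_false (not_not.2 rfl) hgl, iff_of_true hml (hg m (by simp [hml, hm]))]
  exact top_unique fun g _ => key Finset.univ g fun l hl => (hl (Finset.mem_univ l)).elim

end Irredundant

section InvertingSystem

variable {G : Type*} [Group G] {J L : Type*} {V : J → Subgroup G} {z : J → G}
  {P : L → Subgroup G} {g : L → G} {K : Subgroup G}

/-- Distinct noncyclic minimal normal subgroups `V j` inverted by squares `z j`, together with
subgroups `P l` of index two that meet in the subgroup generated by all the `V j` and `z j`. The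
elements `g l` are dual to the `P l` and commute with every `z j`; they witness that the
centralizers of the `z j` together with the `P l` form an irredundant set. -/
structure IsInvertingSystem (V : J → Subgroup G) (z : J → G) (P : L → Subgroup G) (g : L → G) :
    Prop where
  injective : Function.Injective V
  isInvertingSquare : ∀ j, IsInvertingSquare (V j) (z j)
  not_isCyclic : ∀ j, ¬ IsCyclic (V j)
  index_eq_two : ∀ l, (P l).index = 2
  iInf_eq : ⨅ l, P l = (⨆ j, V j) ⊔ Subgroup.closure (Set.range z)
  mem_iff : ∀ l m, g l ∈ P m ↔ m ≠ l
  commute : ∀ l j, Commute (g l) (z j)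

theorem mem_normalizer_zpowers [Finite G] {x u : G} (h : x * u * x⁻¹ ∈ Subgroup.zpowers u) :
    x ∈ Subgroup.normalizer (Subgroup.zpowers u : Set G) := by
  refine Subgroup.mem_normalizer_fintype ?_
  rintro _ ⟨n, rfl⟩
  have hconj := zpow_mem h n
  rwa [conj_zpow] at hconj

namespace IsInvertingSystem

theorem commute_of_ne (h : IsInvertingSystem V z P g) {i j : J} (hij : i ≠ j) {v : G}
    (hv : v ∈ V j) : Commute (z i) v :=
  (h.isInvertingSquare i).commute_of_isMinimalNormal (h.isInvertingSquare j).isMinimalNormal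
    (h.injective.ne hij) hv

theorem iInf_le_normalizer_zpowers [Finite G] (h : IsInvertingSystem V z P g) {j : J} {u : G}
    (hu : u ∈ V j) : ⨅ l, P l ≤ Subgroup.normalizer (Subgroup.zpowers u : Set G) := by
  have hmem : u ∈ Subgroup.zpowers u := Subgroup.mem_zpowers u
  rw [h.iInf_eq, sup_le_iff, iSup_le_iff, Subgroup.closure_le, Set.range_subset_iff]
  refine ⟨fun i v hv => mem_normalizer_zpowers ?_, fun i => mem_normalizer_zpowers ?_⟩
  · have hvu : Commute v u := by
      rcases eq_or_ne i j with rfl | hij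
      · have := (h.isInvertingSquare i).isMulCommutative
        exact setLike_mul_comm hv hu
      · exact (h.isInvertingSquare i).isMinimalNormal.commute
          (h.isInvertingSquare j).isMinimalNormal (h.injective.ne hij) hv hu
    rwa [hvu.mul_inv_cancel]
  · rcases eq_or_ne i j with rfl | hij
    · rw [(h.isInvertingSquare i).conj_eq_inv hu]
      exact inv_mem hmem
    · rwa [(h.commute_of_ne hij hu).mul_inv_cancel]

theorem mem_of_isCoatom_of_not_le [Finite G] [Finite L] (h : IsInvertingSystem V z P g)
    (hK : IsCoatom K) {j : J} (hVK : ¬ V j ≤ K)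
    (hx : ∀ l, ∃ x ∈ K, Commute (z j) x ∧ ∀ m, x ∈ P m ↔ m ≠ l) : z j ∈ K := by
  have hj := h.isInvertingSquare j
  have hn := hj.isMinimalNormal.normal
  obtain ⟨u, hu, hzu⟩ := exists_mul_mem_of_isCoatom hK hVK (z j)
  by_cases hu1 : u = 1
  · simpa [hu1] using hzu
  -- Otherwise `zpowers u` is normal, so `V j` is cyclic.
  have hnormalizer : Subgroup.normalizer (Subgroup.zpowers u : Set G) = ⊤ := by
    refine eq_top_of_iInf_le_of_index_eq_two h.index_eq_two (h.iInf_le_normalizer_zpowers hu)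
      fun l => ?_
    obtain ⟨x, hxK, hzx, hxP⟩ := hx l
    refine ⟨x, mem_normalizer_zpowers ?_, hxP⟩
    rw [(hj.commute_of_mul_mem hK hVK hu hzu hxK hzx).symm.mul_inv_cancel]
    exact Subgroup.mem_zpowers u
  have heq : V j = Subgroup.zpowers u := hj.isMinimalNormal.eq_of_ge
    ⟨Subgroup.normalizer_eq_top_iff.1 hnormalizer, mt Subgroup.zpowers_eq_bot.1 hu1⟩
    (Subgroup.zpowers_le.2 hu)
  exact absurd (heq ▸ inferInstance : IsCyclic (V j)) (h.not_isCyclic j)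

variable (z P) in
/-- The maximal irredundant set attached to an inverting system, as an indexed family. -/
def maximalSubgroup : J ⊕ L → Subgroup G :=
  Sum.elim (fun j => Subgroup.centralizer {z j}) P

theorem isCoatom_maximalSubgroup [Finite G] (h : IsInvertingSystem V z P g) (t : J ⊕ L) :
    IsCoatom (maximalSubgroup z P t) := by
  rcases t with j | l
  · exact (h.isInvertingSquare j).isCoatom_centralizer
  · exact isCoatom_of_index_eq_two (h.index_eq_two l)

theorem exists_notMem_maximalSubgroup (h : IsInvertingSystem V z P g) (t : J ⊕ L) :
    ∃ x, x ∉ maximalSubgroup z P t ∧ ∀ s ≠ t, x ∈ maximalSubgroup z P s := by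
  rcases t with j | l
  · obtain ⟨v, hv, hzv⟩ := (h.isInvertingSquare j).exists_not_commute
    refine ⟨v, fun hvz => hzv (Subgroup.mem_centralizer_singleton_iff.1 hvz).symm, ?_⟩
    rintro (i | m) hne
    · exact Subgroup.mem_centralizer_singleton_iff.2
        (h.commute_of_ne (fun hij => hne (congrArg Sum.inl hij)) hv).symm
    · refine iInf_le P m (h.iInf_eq ▸ Subgroup.mem_sup_left (Subgroup.mem_iSup_of_mem j hv))
  · refine ⟨g l, fun hgl => (h.mem_iff l l).1 hgl rfl, ?_⟩
    rintro (i | m) hne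
    · exact Subgroup.mem_centralizer_singleton_iff.2 (h.commute l i)
    · exact (h.mem_iff l m).2 fun hml => hne (hml ▸ rfl)

theorem maximalSubgroup_injective (h : IsInvertingSystem V z P g) :
    Function.Injective (maximalSubgroup z P) := by
  intro t s hts
  by_contra hne
  obtain ⟨x, hxt, hx⟩ := h.exists_notMem_maximalSubgroup t
  exact hxt (hts ▸ hx s (Ne.symm hne))

theorem mem_range_maximalSubgroup [Finite G] [Finite L] (h : IsInvertingSystem V z P g)
    {S : Set (Subgroup G)} (hS : IsIrredundant S) (hle : Set.range (maximalSubgroup z P) ⊆ S)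
    (hK : K ∈ S) : K ∈ Set.range (maximalSubgroup z P) := by
  by_contra hKM
  have hne (t : J ⊕ L) : maximalSubgroup z P t ≠ K := fun ht => hKM ⟨t, ht⟩
  have hmem (t : J ⊕ L) : maximalSubgroup z P t ∈ S := hle (Set.mem_range_self t)
  by_cases hVK : ∀ j, V j ≤ K
  · obtain ⟨x, hxK, hx⟩ := hS.exists_notMem_forall_mem hK
    have hPK : ⨅ l, P l ≤ K := by
      rw [h.iInf_eq, sup_le_iff, iSup_le_iff, Subgroup.closure_le, Set.range_subset_iff]
      exact ⟨hVK, fun j => (h.isInvertingSquare j).mem_of_isCoatom (hS.1 K hK) (hVK j)⟩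
    exact hxK (hPK (Subgroup.mem_iInf.2 fun l => hx _ (hmem (.inr l)) (hne (.inr l))))
  · obtain ⟨j, hj⟩ := not_forall.1 hVK
    refine hne (.inl j) ((h.isInvertingSquare j).eq_centralizer (hS.1 K hK) hj
      (h.mem_of_isCoatom_of_not_le (hS.1 K hK) hj fun l => ?_)).symm
    obtain ⟨x, hxl, hx⟩ := hS.exists_notMem_forall_mem (hmem (.inr l))
    have hxt (t : J ⊕ L) (ht : t ≠ .inr l) : x ∈ maximalSubgroup z P t :=
      hx _ (hmem t) (h.maximalSubgroup_injective.ne ht)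
    refine ⟨x, hx K hK (hne (.inr l)).symm,
      (Subgroup.mem_centralizer_singleton_iff.1 (hxt (.inl j) Sum.inl_ne_inr)).symm,
      fun m => ⟨?_, fun hml => hxt (.inr m) (Sum.inr_injective.ne hml)⟩⟩
    rintro hxm rfl
    exact hxl hxm

theorem Mindim_le [Finite G] [Finite J] [Finite L] (h : IsInvertingSystem V z P g) :
    Mindim G ≤ Nat.card J + Nat.card L := by
  let M := Set.range (maximalSubgroup z P)
  have hM : IsMaximalIrredundant M :=
    ⟨isIrredundant_range h.isCoatom_maximalSubgroup h.exists_notMem_maximalSubgroup,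
      fun S hS hle K hK => h.mem_range_maximalSubgroup hS hle hK⟩
  calc Mindim G ≤ M.ncard := Nat.sInf_le ⟨M, hM, rfl⟩
    _ ≤ Nat.card (J ⊕ L) := by
      rw [← Nat.card_coe_set_eq]
      exact Finite.card_range_le _
    _ = Nat.card J + Nat.card L := Nat.card_sum

end IsInvertingSystem

end InvertingSystem

section Pi

variable {ι : Type*} [DecidableEq ι] {G : ι → Type*} [∀ i, Group (G i)] {i : ι}

theorem mul_mulSingle_mul_inv (x : ∀ i, G i) (v : G i) :
    x * Pi.mulSingle i v * x⁻¹ = Pi.mulSingle i (x i * v * (x i)⁻¹) := by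
  ext j
  rcases eq_or_ne j i with rfl | hji
  · simp
  · simp [hji]

theorem IsMinimalNormal.map_mulSingle {V : Subgroup (G i)} (hV : IsMinimalNormal V) :
    IsMinimalNormal (V.map (MonoidHom.mulSingle G i)) := by
  have hinj : Function.Injective (MonoidHom.mulSingle G i) := Pi.mulSingle_injective i
  refine ⟨⟨⟨?_⟩, mt (Subgroup.map_eq_bot_iff_of_injective V hinj).1 hV.ne_bot⟩,
    fun W ⟨hW, hWbot⟩ hWV => Subgroup.map_le_iff_le_comap.2 (hV.2 ⟨⟨?_⟩, ?_⟩ ?_)⟩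
  · rintro _ ⟨v, hv, rfl⟩ x
    exact ⟨_, hV.normal.conj_mem v hv (x i), (mul_mulSingle_mul_inv x v).symm⟩
  · intro v hv g
    simpa [mul_mulSingle_mul_inv] using! hW.conj_mem _ hv (Pi.mulSingle i g)
  · refine fun hbot => hWbot ((Subgroup.eq_bot_iff_forall W).2 fun w hw => ?_)
    obtain ⟨v, -, rfl⟩ := hWV hw
    rw [(Subgroup.eq_bot_iff_forall _).1 hbot v hw, map_one]
  · rw [← Subgroup.comap_map_eq_self_of_injective hinj V]
    exact Subgroup.comap_mono hWV

theorem IsInvertingSquare.map_mulSingle {V : Subgroup (G i)} {z : G i}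
    (h : IsInvertingSquare V z) :
    IsInvertingSquare (V.map (MonoidHom.mulSingle G i)) (Pi.mulSingle i z) where
  isMinimalNormal := h.isMinimalNormal.map_mulSingle
  isMulCommutative := by
    have := h.isMulCommutative
    infer_instance
  commutator_mem x := by
    refine ⟨⁅z, x i⁆, h.commutator_mem (x i), ?_⟩
    calc Pi.mulSingle i ⁅z, x i⁆ = Pi.mulSingle i z * Pi.mulSingle i (x i * z⁻¹ * (x i)⁻¹) := by
          rw [← Pi.mulSingle_mul, commutatorElement_def]
          simp only [mul_assoc]
      _ = ⁅Pi.mulSingle i z, x⁆ := by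
          rw [← mul_mulSingle_mul_inv, Pi.mulSingle_inv, commutatorElement_def]
          simp only [mul_assoc]
  isSquare := h.isSquare.map (MonoidHom.mulSingle G i)
  sq_eq_one := by rw [← Pi.mulSingle_pow, h.sq_eq_one, Pi.mulSingle_one]
  exists_not_commute := by
    obtain ⟨v, hv, hzv⟩ := h.exists_not_commute
    refine ⟨_, ⟨v, hv, rfl⟩, fun hcomm => hzv ?_⟩
    simpa using hcomm.map (Pi.evalMonoidHom G i)

variable {J L : ι → Type*} {V : ∀ i, J i → Subgroup (G i)} {z : ∀ i, J i → G i}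
  {P : ∀ i, L i → Subgroup (G i)} {g : ∀ i, L i → G i}

theorem IsInvertingSystem.iInf_comap_eval [Finite ι]
    (h : ∀ i, IsInvertingSystem (V i) (z i) (P i) (g i)) :
    ⨅ l : Σ i, L i, (P l.1 l.2).comap (Pi.evalMonoidHom G l.1) =
      (⨆ j : Σ i, J i, (V j.1 j.2).map (MonoidHom.mulSingle G j.1)) ⊔
        Subgroup.closure (Set.range fun j : Σ i, J i => Pi.mulSingle j.1 (z j.1 j.2)) := by
  refine le_antisymm (fun x hx => Subgroup.pi_mem_of_mulSingle_mem x fun i => ?_)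
    (le_iInf fun l => ?_)
  · have hxi : x i ∈ ⨅ l, P i l :=
      Subgroup.mem_iInf.2 fun l => Subgroup.mem_iInf.1 hx ⟨i, l⟩
    refine (?_ : Subgroup.map (MonoidHom.mulSingle G i) (⨅ l, P i l) ≤ _) ⟨x i, hxi, rfl⟩
    rw [(h i).iInf_eq, Subgroup.map_le_iff_le_comap, sup_le_iff, iSup_le_iff, Subgroup.closure_le,
      Set.range_subset_iff]
    exact ⟨fun j => Subgroup.map_le_iff_le_comap.1
        (le_sup_of_le_left (le_iSup_of_le ⟨i, j⟩ le_rfl)),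
      fun j => Subgroup.mem_sup_right (Subgroup.subset_closure ⟨⟨i, j⟩, rfl⟩)⟩
  · have hle (i : ι) : (⨅ m, P i m).map (MonoidHom.mulSingle G i) ≤
        (P l.1 l.2).comap (Pi.evalMonoidHom G l.1) := by
      rintro _ ⟨y, hy, rfl⟩
      rcases eq_or_ne l.1 i with rfl | hli
      · simpa using! Subgroup.mem_iInf.1 hy l.2
      · simp [hli]
    rw [sup_le_iff, iSup_le_iff, Subgroup.closure_le, Set.range_subset_iff]
    refine ⟨fun j => (Subgroup.map_mono ?_).trans (hle j.1), fun j => hle j.1 ⟨_, ?_, rfl⟩⟩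
    · rw [(h j.1).iInf_eq]
      exact le_sup_of_le_left (le_iSup _ j.2)
    · rw [SetLike.mem_coe, (h j.1).iInf_eq]
      exact Subgroup.mem_sup_right (Subgroup.subset_closure ⟨j.2, rfl⟩)

theorem IsInvertingSystem.pi [Finite ι] (h : ∀ i, IsInvertingSystem (V i) (z i) (P i) (g i)) :
    IsInvertingSystem (fun j : Σ i, J i => (V j.1 j.2).map (MonoidHom.mulSingle G j.1))
      (fun j => Pi.mulSingle j.1 (z j.1 j.2))
      (fun l : Σ i, L i => (P l.1 l.2).comap (Pi.evalMonoidHom G l.1))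
      (fun l => Pi.mulSingle l.1 (g l.1 l.2)) where
  injective := by
    rintro ⟨i, j⟩ ⟨i', j'⟩ heq
    dsimp only at heq
    obtain ⟨v, hv, hzv⟩ := ((h i).isInvertingSquare j).exists_not_commute
    obtain ⟨w, -, hw⟩ := heq ▸ Subgroup.mem_map_of_mem (MonoidHom.mulSingle G i) hv
    obtain rfl : i' = i := by
      by_contra hne
      have hv1 : v = 1 := by simpa [hne, Ne.symm hne] using (congrFun hw i).symm
      exact hzv (hv1 ▸ Commute.one_right _)
    rw [(h i').injective (Subgroup.map_injective (Pi.mulSingle_injective i') heq)]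
  isInvertingSquare j := ((h j.1).isInvertingSquare j.2).map_mulSingle
  not_isCyclic j := by
    have e := (V j.1 j.2).equivMapOfInjective (MonoidHom.mulSingle G j.1)
      (Pi.mulSingle_injective j.1)
    exact e.isCyclic.not.1 ((h j.1).not_isCyclic j.2)
  index_eq_two l := by
    rw [Subgroup.index_comap_of_surjective _ (Function.surjective_eval l.1)]
    exact (h l.1).index_eq_two l.2
  iInf_eq := IsInvertingSystem.iInf_comap_eval h
  mem_iff := by
    rintro ⟨i, l⟩ ⟨i', m⟩
    rcases eq_or_ne i' i with rfl | hne
    · simpa using! (h i').mem_iff l m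
    · simp [hne]
  commute l j := by
    rcases eq_or_ne l.1 j.1 with heq | hne
    · obtain ⟨i, l⟩ := l
      obtain rfl : i = j.1 := heq
      exact ((h j.1).commute l j.2).map (MonoidHom.mulSingle G j.1)
    · exact Pi.mulSingle_commute hne _ _

end Pi

section GroupX

/-- The parity of the rotation index of an element of `D8`. -/
def rotParity : D8 →* Multiplicative (ZMod 2) where
  toFun g := match g with
    | .r i => .ofAdd (ZMod.castHom (by decide : 2 ∣ 4) (ZMod 2) i)
    | .sr i => .ofAdd (ZMod.castHom (by decide : 2 ∣ 4) (ZMod 2) i)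
  map_one' := by decide
  map_mul' := by decide +kernel

/-- The homomorphism from `D8` to a group of order two whose kernel is the rotation subgroup. -/
def reflParity : D8 →* Multiplicative (ZMod 2) where
  toFun g := match g with
    | .r _ => .ofAdd 0
    | .sr _ => .ofAdd 1
  map_one' := by decide
  map_mul' := by decide +kernel

/-- The involutions of the Frattini subgroup of `X` with a single nontrivial coordinate, numbered
so that `N i` is generated by those of index different from `i`. -/
def centralInvolution : Fin 3 → X := ![y₁ * y₂ * y₃, y₂, y₁]

theorem exists_coe_word_eq (p q r : D8) (hq : rotParity q = reflParity p)
    (hq' : reflParity q = rotParity p * reflParity p) (hr : rotParity r = reflParity p)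
    (hr' : reflParity r = rotParity p) :
    ∃ (i j : Fin 2) (k : Fin 3 → Fin 2), ((x₁ ^ i.val * x₂ ^ j.val *
      (centralInvolution 0 ^ (k 0).val * centralInvolution 1 ^ (k 1).val *
        centralInvolution 2 ^ (k 2).val) : X) : D8 × D8 × D8) = (p, q, r) := by
  revert p q r
  decide +kernel

theorem mem_X_iff {g : D8 × D8 × D8} :
    g ∈ X ↔ rotParity g.2.1 = reflParity g.1 ∧
      reflParity g.2.1 = rotParity g.1 * reflParity g.1 ∧
      rotParity g.2.2 = reflParity g.1 ∧ reflParity g.2.2 = rotParity g.1 := by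
  refine ⟨fun hg => ?_, fun ⟨hq, hq', hr, hr'⟩ => ?_⟩
  · have eq_of_generators (φ ψ : D8 × D8 × D8 →* Multiplicative (ZMod 2))
        (h₁ : φ (a, b, b) = ψ (a, b, b)) (h₂ : φ (b, a * b, a) = ψ (b, a * b, a)) : φ g = ψ g :=
      MonoidHom.eqOn_closure (by rintro _ (rfl | rfl) <;> assumption) hg
    let π₁ := MonoidHom.fst D8 (D8 × D8)
    let π₂ := (MonoidHom.fst D8 D8).comp (MonoidHom.snd D8 (D8 × D8))
    let π₃ := (MonoidHom.snd D8 D8).comp (MonoidHom.snd D8 (D8 × D8))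
    exact ⟨eq_of_generators (rotParity.comp π₂) (reflParity.comp π₁) (by decide) (by decide),
      eq_of_generators (reflParity.comp π₂) ((rotParity * reflParity).comp π₁) (by decide)
        (by decide),
      eq_of_generators (rotParity.comp π₃) (reflParity.comp π₁) (by decide) (by decide),
      eq_of_generators (reflParity.comp π₃) (rotParity.comp π₁) (by decide) (by decide)⟩
  · obtain ⟨i, j, k, hg⟩ := exists_coe_word_eq g.1 g.2.1 g.2.2 hq hq' hr hr'
    exact (congrArg (· ∈ X) hg).mp (SetLike.coe_mem _)

instance : DecidablePred (· ∈ X) := fun _ => decidable_of_iff' _ mem_X_iff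

instance : Fintype X := inferInstanceAs (Fintype {g : D8 × D8 × D8 // g ∈ X})

theorem card_X : Nat.card X = 32 := by
  rw [Nat.card_eq_fintype_card]
  decide +kernel

theorem closure_generators : Subgroup.closure {x₁, x₂} = ⊤ := by
  refine Eq.trans (congrArg _ ?_) (Subgroup.closure_closure_coe_preimage
    (k := ({(a, b, b), (b, a * b, a)} : Set (D8 × D8 × D8))))
  exact Set.ext fun x => or_congr Subtype.ext_iff Subtype.ext_iff

/-- The three coordinate projections of `X`, numbered so that the `i`-th has kernel `N i`. -/
def proj : Fin 3 → X →* D8 :=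
  ![((MonoidHom.fst D8 D8).comp (MonoidHom.snd D8 (D8 × D8))).comp X.subtype,
    ((MonoidHom.snd D8 D8).comp (MonoidHom.snd D8 (D8 × D8))).comp X.subtype,
    (MonoidHom.fst D8 (D8 × D8)).comp X.subtype]

theorem proj_surjective (i : Fin 3) : Function.Surjective (proj i) := by
  revert i
  unfold Function.Surjective
  decide +kernel

theorem eq_one_of_forall_proj_eq_one {x : X} (h : ∀ i, proj i x = 1) : x = 1 :=
  Subtype.ext (Prod.ext (h 2) (Prod.ext (h 0) (h 1)))

theorem proj_centralInvolution_eq_one_iff (i j : Fin 3) :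
    proj j (centralInvolution i) = 1 ↔ j ≠ i := by
  revert i j
  decide +kernel

theorem N_eq_closure (i : Fin 3) :
    N i = Subgroup.closure {centralInvolution (i + 1), centralInvolution (i + 2)} := by
  fin_cases i
  · exact congrArg Subgroup.closure (Set.pair_comm y₁ y₂)
  · rfl
  · exact congrArg Subgroup.closure (Set.pair_comm y₂ (y₁ * y₂ * y₃))

theorem exists_pow_mul_pow_eq_of_proj_eq_one (i : Fin 3) (x : X) (hx : proj i x = 1) :
    ∃ k l : Fin 2,
      centralInvolution (i + 1) ^ k.val * centralInvolution (i + 2) ^ l.val = x := by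
  revert i x
  decide +kernel

theorem ker_proj (i : Fin 3) : (proj i).ker = N i := by
  rw [N_eq_closure]
  refine le_antisymm (fun x hx => ?_) ((Subgroup.closure_le _).2 ?_)
  · obtain ⟨k, l, rfl⟩ := exists_pow_mul_pow_eq_of_proj_eq_one i x hx
    exact mul_mem (pow_mem (Subgroup.subset_closure (by simp)) _)
      (pow_mem (Subgroup.subset_closure (by simp)) _)
  · rw [Set.insert_subset_iff, Set.singleton_subset_iff]
    exact ⟨(proj_centralInvolution_eq_one_iff (i + 1) i).2 (by simp),
      (proj_centralInvolution_eq_one_iff (i + 2) i).2 (by simp)⟩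

theorem nonempty_quotient_N (i : Fin 3) :
    ∃ _ : (N i).Normal, Nonempty (X ⧸ N i ≃* D8) := by
  rw [← ker_proj]
  exact ⟨inferInstance, ⟨QuotientGroup.quotientKerEquivOfSurjective _ (proj_surjective i)⟩⟩

end GroupX

section FreeKernel

/-- The surjection from the free group that sends the generators to `x₁` and `x₂`. -/
def freeMap : FreeGroup (Fin 2) →* X := FreeGroup.lift ![x₁, x₂]

theorem freeMap_surjective : Function.Surjective freeMap := by
  rw [← MonoidHom.range_eq_top, freeMap, FreeGroup.range_lift_eq_closure, ← closure_generators,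
    Matrix.range_cons_cons_empty]

theorem freeGroup_hom_ext_fin_two {G : Type*} [Group G] {φ ψ : FreeGroup (Fin 2) →* G}
    (h₀ : φ (.of 0) = ψ (.of 0)) (h₁ : φ (.of 1) = ψ (.of 1)) : φ = ψ :=
  FreeGroup.ext_hom φ ψ (Fin.forall_fin_two.2 ⟨h₀, h₁⟩)

/-- The endomorphism `r i ↦ r (e * i)`, `sr i ↦ sr (e * i + c)` of the dihedral group. -/
def dihedralEnd {n : ℕ} (e c : ZMod n) : DihedralGroup n →* DihedralGroup n where
  toFun g := match g with
    | .r i => .r (e * i)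
    | .sr i => .sr (e * i + c)
  map_one' := congrArg DihedralGroup.r (mul_zero e)
  map_mul' := by rintro (i | i) (j | j) <;> simp <;> ring

theorem exists_character_or_exists_proj (u v : D8) :
    (∃ χ : D8 →* Multiplicative (ZMod 2), χ ≠ 1 ∧ χ u = 1 ∧ χ v = 1) ∨
      ∃ (f : D8 →* D8) (i : Fin 3), f (proj i x₁) = u ∧ f (proj i x₂) = v := by
  let χ : Fin 3 → D8 →* Multiplicative (ZMod 2) :=
    ![rotParity, reflParity, rotParity * reflParity]
  have hχ : ∀ j, ∃ d, χ j d ≠ 1 := by decide +kernel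
  have key : ∀ u v : D8, (∃ j, χ j u = 1 ∧ χ j v = 1) ∨
      ∃ e c i, dihedralEnd e c (proj i x₁) = u ∧ dihedralEnd e c (proj i x₂) = v := by
    decide +kernel
  rcases key u v with ⟨j, hu, hv⟩ | ⟨e, c, i, hu, hv⟩
  · obtain ⟨d, hd⟩ := hχ j
    exact Or.inl ⟨χ j, fun h => hd (DFunLike.congr_fun h d), hu, hv⟩
  · exact Or.inr ⟨dihedralEnd e c, i, hu, hv⟩

theorem exists_eq_comp_freeMap {φ : FreeGroup (Fin 2) →* D8} (hφ : Function.Surjective φ) :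
    ∃ f : X →* D8, φ = f.comp freeMap := by
  rcases exists_character_or_exists_proj (φ (.of 0)) (φ (.of 1)) with
    ⟨χ, hχ, h₀, h₁⟩ | ⟨f, i, h₀, h₁⟩
  · have hχφ : χ.comp φ = MonoidHom.comp 1 φ := freeGroup_hom_ext_fin_two h₀ h₁
    exact absurd ((MonoidHom.cancel_right hφ).1 hχφ) hχ
  · refine ⟨f.comp (proj i), freeGroup_hom_ext_fin_two ?_ ?_⟩
    · simpa [freeMap] using! h₀.symm
    · simpa [freeMap] using! h₁.symm

theorem ker_freeMap : freeMap.ker = freeKernel := by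
  refine le_antisymm (le_sInf ?_) fun w hw => ?_
  · rintro K ⟨hK, ⟨e⟩⟩ w hw
    obtain ⟨f, hf⟩ := exists_eq_comp_freeMap (φ := e.toMonoidHom.comp (QuotientGroup.mk' K))
      (e.surjective.comp (QuotientGroup.mk'_surjective K))
    have hew : e (w : FreeGroup (Fin 2) ⧸ K) = f (freeMap w) := DFunLike.congr_fun hf w
    rw [MonoidHom.mem_ker.1 hw, map_one] at hew
    exact (QuotientGroup.eq_one_iff w).1 ((MulEquiv.map_eq_one_iff e).1 hew)
  · refine eq_one_of_forall_proj_eq_one fun i => ?_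
    have hmem := Subgroup.mem_sInf.1 hw ((proj i).comp freeMap).ker ⟨inferInstance,
      ⟨QuotientGroup.quotientKerEquivOfSurjective _
        ((proj_surjective i).comp freeMap_surjective)⟩⟩
    exact hmem

theorem nonempty_quotient_freeKernel :
    Nonempty (FreeGroup (Fin 2) ⧸ freeKernel ≃* X) :=
  ⟨(QuotientGroup.quotientMulEquivOfEq ker_freeMap.symm).trans
    (QuotientGroup.quotientKerEquivOfSurjective _ freeMap_surjective)⟩

end FreeKernel

section CentralInvolution

theorem centralInvolution_sq (i : Fin 3) : centralInvolution i ^ 2 = 1 := by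
  revert i
  decide +kernel

theorem isSquare_centralInvolution (i : Fin 3) : IsSquare (centralInvolution i) :=
  ⟨![x₁ * x₂, x₂, x₁] i, by revert i; decide +kernel⟩

theorem centralInvolution_commute (i : Fin 3) (x : X) : Commute (centralInvolution i) x := by
  revert i x
  unfold Commute SemiconjBy
  decide +kernel

/-- The homomorphisms from `X` to a group of order two that are dual to the generators
`x₁`, `x₂`. -/
def parity (j : Fin 2) : X →* Multiplicative (ZMod 2) :=
  reflParity.comp (proj j.succ)

theorem parity_generator_eq_one_iff (i j : Fin 2) : parity j (![x₁, x₂] i) = 1 ↔ j ≠ i := by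
  revert i j
  decide +kernel

theorem parity_centralInvolution (i : Fin 3) (j : Fin 2) :
    parity j (centralInvolution i) = 1 := by
  revert i j
  decide +kernel

theorem index_ker_parity (j : Fin 2) : (parity j).ker.index = 2 := by
  have hsurj : Function.Surjective (parity j) := by
    have hrefl : Function.Surjective reflParity := by decide +kernel
    exact hrefl.comp (proj_surjective j.succ)
  rw [Subgroup.index_ker, MonoidHom.range_eq_top.2 hsurj, Subgroup.card_top]
  exact Nat.card_zmod 2

theorem exists_prod_pow_eq_of_parity_eq_one (x : X) (hx : ∀ j, parity j x = 1) :
    ∃ k : Fin 3 → Fin 2, centralInvolution 0 ^ (k 0).val * centralInvolution 1 ^ (k 1).val *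
      centralInvolution 2 ^ (k 2).val = x := by
  revert x
  decide +kernel

theorem iInf_ker_parity :
    ⨅ j, (parity j).ker = Subgroup.closure (Set.range centralInvolution) := by
  refine le_antisymm (fun x hx => ?_) ((Subgroup.closure_le _).2 ?_)
  · have hmem (i : Fin 3) (k : ℕ) :
        centralInvolution i ^ k ∈ Subgroup.closure (Set.range centralInvolution) :=
      pow_mem (Subgroup.subset_closure (Set.mem_range_self i)) k
    obtain ⟨k, rfl⟩ :=
      exists_prod_pow_eq_of_parity_eq_one x fun j => Subgroup.mem_iInf.1 hx j
    exact mul_mem (mul_mem (hmem 0 _) (hmem 1 _)) (hmem 2 _)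
  · rintro _ ⟨i, rfl⟩
    exact Subgroup.mem_iInf.2 (parity_centralInvolution i)

end CentralInvolution

section Modules

variable {k Q R U : Type*} [Field k] [Group Q] [Group R] [AddCommGroup U] [Module k U]

theorem isIrreducible_of_forall_submodule [Nontrivial U] {ρ : Representation k Q U}
    (h : ∀ W : Submodule k U, (∀ x, ∀ v ∈ W, ρ x v ∈ W) → W = ⊥ ∨ W = ⊤) :
    ρ.IsIrreducible where
  exists_pair_ne := ⟨⊥, ⊤, ne_of_apply_ne Subrepresentation.toSubmodule bot_ne_top⟩
  eq_bot_or_eq_top W :=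
    (h W.toSubmodule fun x _ hv => W.apply_mem_toSubmodule x hv).imp
      (fun hW => Subrepresentation.toSubmodule_injective hW)
      (fun hW => Subrepresentation.toSubmodule_injective hW)

theorem submodule_eq_bot_or_eq_top {ρ : Representation k Q U} (hρ : ρ.IsIrreducible)
    (W : Submodule k U) (hW : ∀ x, ∀ v ∈ W, ρ x v ∈ W) : W = ⊥ ∨ W = ⊤ :=
  (hρ.eq_bot_or_eq_top ⟨W, fun x v hv => hW x v hv⟩).imp
    (congrArg Subrepresentation.toSubmodule) (congrArg Subrepresentation.toSubmodule)

theorem isIrreducible_comp_of_surjective [Nontrivial U] {ρ : Representation k Q U}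
    (hρ : ρ.IsIrreducible) {f : R →* Q} (hf : Function.Surjective f) :
    Representation.IsIrreducible (ρ.comp f) :=
  isIrreducible_of_forall_submodule fun W hW =>
    submodule_eq_bot_or_eq_top hρ W (hf.forall.2 hW)

/-- The faithful representation of `D8` by monomial matrices over the field with three elements. -/
def dihedralRep : Representation (ZMod 3) D8 (Fin 2 → ZMod 3) :=
  (Matrix.toLinAlgEquiv' : _ ≃ₐ[ZMod 3] _).toMonoidHom.comp
    { toFun := fun g => match g with
        | .r i => !![0, -1; 1, 0] ^ i.val
        | .sr i => !![1, 0; 0, -1] * !![0, -1; 1, 0] ^ i.val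
      map_one' := by decide +kernel
      map_mul' := by decide +kernel }

theorem dihedralRep_injective : Function.Injective dihedralRep := by
  refine (injective_iff_map_eq_one dihedralRep).2 fun d hd => ?_
  have key : ∀ d, (∀ v, dihedralRep d v = v) → d = 1 := by decide +kernel
  exact key d fun v => by rw [hd, Module.End.one_apply]

theorem isIrreducible_dihedralRep : dihedralRep.IsIrreducible := by
  have key : ∀ w : Fin 2 → ZMod 3, w ≠ 0 → ∀ u, ∃ s t : ZMod 3,
      s • w + t • dihedralRep a w = u := by decide +kernel
  refine isIrreducible_of_forall_submodule fun W hW => or_iff_not_imp_left.2 fun hbot => ?_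
  obtain ⟨w, hw, hw0⟩ := Submodule.exists_mem_ne_zero_of_ne_bot hbot
  refine top_unique fun u _ => ?_
  obtain ⟨s, t, rfl⟩ := key w hw0 u
  exact add_mem (W.smul_mem s hw) (W.smul_mem t (hW a w hw))

/-- The faithful two-dimensional representation of `D8` pulled back along the three projections
of `X`, an instance of the modules `A₁`, `A₂`, `A₃`. -/
def dihedralTriple (i : Fin 3) : Representation (ZMod 3) X (Fin 2 → ZMod 3) :=
  dihedralRep.comp (proj i)

theorem isModuleTriple_dihedralTriple : IsModuleTriple dihedralTriple := by
  refine fun i => ⟨?_, Module.finrank_fin_fun (ZMod 3), ?_⟩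
  · exact isIrreducible_comp_of_surjective isIrreducible_dihedralRep (proj_surjective i)
  · exact (MonoidHom.ker_comp_of_injective (proj i) dihedralRep dihedralRep_injective).trans
      (ker_proj i)

theorem map_eq_neg_of_central_involution {ρ : Representation k Q U} (hρ : ρ.IsIrreducible) {z : Q}
    (hz : z ^ 2 = 1) (hcomm : ∀ x, Commute z x) (hne : ρ z ≠ 1) (v : U) : ρ z v = -v := by
  have hmem (u : U) : u ∈ LinearMap.eqLocus (ρ z) 1 ↔ ρ z u = u := Iff.rfl
  have hinv (x : Q) (u : U) (hu : u ∈ LinearMap.eqLocus (ρ z) 1) :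
      ρ x u ∈ LinearMap.eqLocus (ρ z) 1 := by
    rw [hmem] at hu ⊢
    rw [← Module.End.mul_apply, ← map_mul, (hcomm x).eq, map_mul, Module.End.mul_apply, hu]
  have hfix : LinearMap.eqLocus (ρ z) 1 = ⊥ :=
    (submodule_eq_bot_or_eq_top hρ _ hinv).resolve_right fun htop =>
      hne (LinearMap.eqLocus_eq_top.1 htop)
  have hsum : v + ρ z v ∈ LinearMap.eqLocus (ρ z) 1 := by
    rw [hmem, map_add, ← Module.End.mul_apply, ← map_mul, ← sq, hz, map_one,
      Module.End.one_apply, add_comm]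
  rw [hfix, Submodule.mem_bot] at hsum
  exact eq_neg_of_add_eq_zero_right hsum

theorem addSubgroup_eq_bot_or_eq_top {p : ℕ} [Fact p.Prime] [Module (ZMod p) U]
    {ρ : Representation (ZMod p) Q U} (hρ : ρ.IsIrreducible) (S : AddSubgroup U)
    (hS : ∀ x, ∀ v ∈ S, ρ x v ∈ S) : S = ⊥ ∨ S = ⊤ :=
  (submodule_eq_bot_or_eq_top hρ (AddSubgroup.toZModSubmodule p S) hS).imp
    (fun h => (AddSubgroup.toZModSubmodule p).injective (by rw [h, map_bot]))
    (fun h => (AddSubgroup.toZModSubmodule p).injective (by rw [h, map_top]))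

theorem finrank_le_one_of_isAddCyclic {p : ℕ} [Fact p.Prime] [Module (ZMod p) U] [IsAddCyclic U] :
    Module.finrank (ZMod p) U ≤ 1 := by
  obtain ⟨v, hv⟩ := IsAddCyclic.exists_generator (α := U)
  refine finrank_le_one v fun w => ?_
  obtain ⟨n, rfl⟩ := AddSubgroup.mem_zmultiples_iff.1 (hv w)
  exact ⟨n, Int.cast_smul_eq_zsmul _ _ _⟩

end Modules

theorem isSolvable_pi {ι : Type*} [Finite ι] {G : ι → Type*} [∀ i, Group (G i)]
    [h : ∀ i, Group.IsSolvable (G i)] : Group.IsSolvable (∀ i, G i) := by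
  choose n hn using fun i => (h i).solvable
  obtain ⟨m, hm⟩ := Finite.exists_le n
  refine ⟨m, (Subgroup.eq_bot_iff_forall _).2 fun x hx => funext fun i => ?_⟩
  have hxi := map_derivedSeries_le_derivedSeries (Pi.evalMonoidHom G i) m
    (Subgroup.mem_map_of_mem _ hx)
  exact Subgroup.mem_bot.1 (hn i ▸ derivedSeries_antitone (G i) (hm i) hxi)

section SemiProd

variable {A : Fin 3 → Type*} [∀ i, AddCommGroup (A i)] [∀ i, Module (ZMod 3) (A i)]
  {ρ : ∀ i, Representation (ZMod 3) X (A i)}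

theorem IsModuleTriple.nontrivial (hρ : IsModuleTriple ρ) (i : Fin 3) : Nontrivial (A i) :=
  Module.nontrivial_of_finrank_pos (R := ZMod 3) (by simp [(hρ i).2.1])

theorem IsModuleTriple.finite (hρ : IsModuleTriple ρ) (i : Fin 3) : Finite (A i) :=
  have : Module.Finite (ZMod 3) (A i) := Module.finite_of_finrank_pos (by simp [(hρ i).2.1])
  Module.finite_of_finite (ZMod 3)

theorem map_eq_one_iff_proj_eq_one (hρ : IsModuleTriple ρ) (i : Fin 3) (x : X) :
    ρ i x = 1 ↔ proj i x = 1 := by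
  rw [← MonoidHom.mem_ker, (hρ i).2.2, ← ker_proj, MonoidHom.mem_ker]

theorem map_centralInvolution_self (hρ : IsModuleTriple ρ) (i : Fin 3) (v : A i) :
    ρ i (centralInvolution i) v = -v :=
  map_eq_neg_of_central_involution (hρ i).1 (centralInvolution_sq i) (centralInvolution_commute i)
    (mt (map_eq_one_iff_proj_eq_one hρ i _).1
      fun h => (proj_centralInvolution_eq_one_iff i i).1 h rfl) v

theorem map_centralInvolution_of_ne (hρ : IsModuleTriple ρ) {i j : Fin 3} (hij : j ≠ i) :
    ρ j (centralInvolution i) = 1 :=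
  (map_eq_one_iff_proj_eq_one hρ j _).2 ((proj_centralInvolution_eq_one_iff i j).2 hij)

theorem ext_semiProd {g h : SemiProd ρ} (hl : ∀ i, g.left.toAdd i = h.left.toAdd i)
    (hr : g.right = h.right) : g = h :=
  SemidirectProduct.ext (Multiplicative.toAdd.injective (funext hl)) hr

theorem mul_left_apply (g h : SemiProd ρ) (i : Fin 3) :
    (g * h).left.toAdd i = g.left.toAdd i + ρ i g.right (h.left.toAdd i) := rfl

variable (ρ) in
/-- The inclusion of the `i`-th module into the semidirect product. -/
def moduleHom (i : Fin 3) : Multiplicative (A i) →* SemiProd ρ :=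
  SemidirectProduct.inl.comp (AddMonoidHom.toMultiplicative (AddMonoidHom.single A i))

theorem moduleHom_left_apply_self (i : Fin 3) (u : Multiplicative (A i)) :
    (moduleHom ρ i u).left.toAdd i = u.toAdd := Pi.single_eq_same i u.toAdd

theorem moduleHom_left_apply_of_ne {i j : Fin 3} (hij : j ≠ i) (u : Multiplicative (A i)) :
    (moduleHom ρ i u).left.toAdd j = 0 := Pi.single_eq_of_ne hij u.toAdd

theorem moduleHom_right (i : Fin 3) (u : Multiplicative (A i)) : (moduleHom ρ i u).right = 1 := rfl

theorem moduleHom_injective (i : Fin 3) : Function.Injective (moduleHom ρ i) :=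
  SemidirectProduct.inl_injective.comp (Pi.single_injective i)

theorem mul_moduleHom_mul_inv (i : Fin 3) (g : SemiProd ρ) (u : Multiplicative (A i)) :
    g * moduleHom ρ i u * g⁻¹ = moduleHom ρ i (.ofAdd (ρ i g.right u.toAdd)) := by
  rw [mul_inv_eq_iff_eq_mul]
  refine ext_semiProd (fun j => ?_) (by simp [moduleHom_right])
  rw [mul_left_apply, mul_left_apply, moduleHom_right, map_one, Module.End.one_apply, add_comm]
  rcases eq_or_ne j i with rfl | hji
  · simp only [moduleHom_left_apply_self, toAdd_ofAdd]
  · simp only [moduleHom_left_apply_of_ne hji, map_zero]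

theorem moduleHom_mem_of_normal {i : Fin 3} (hρ : (ρ i).IsIrreducible) {W : Subgroup (SemiProd ρ)}
    [hW : W.Normal] {u : Multiplicative (A i)} (hu : u ≠ 1) (huW : moduleHom ρ i u ∈ W)
    (v : Multiplicative (A i)) : moduleHom ρ i v ∈ W := by
  let S : AddSubgroup (A i) := (W.comap (moduleHom ρ i)).toAddSubgroup'
  have hS (x : X) (w : A i) (hw : w ∈ S) : ρ i x w ∈ S := by
    have := hW.conj_mem _ hw (SemidirectProduct.inr x)
    rwa [mul_moduleHom_mul_inv] at this
  have htop : S = ⊤ := (addSubgroup_eq_bot_or_eq_top hρ S hS).resolve_left fun hbot =>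
    hu (toAdd_eq_zero.1 (AddSubgroup.mem_bot.1 (hbot.le huW)))
  exact htop.ge (AddSubgroup.mem_top v.toAdd)

theorem isMinimalNormal_range_moduleHom {i : Fin 3} (hρ : (ρ i).IsIrreducible) [Nontrivial (A i)] :
    IsMinimalNormal (moduleHom ρ i).range := by
  refine ⟨⟨⟨?_⟩, ?_⟩, fun W ⟨hW, hWbot⟩ hWV => ?_⟩
  · rintro _ ⟨u, rfl⟩ g
    exact ⟨_, (mul_moduleHom_mul_inv i g u).symm⟩
  · obtain ⟨u, hu⟩ := exists_ne (1 : Multiplicative (A i))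
    exact fun hbot => hu (moduleHom_injective i
      ((Subgroup.mem_bot.1 (hbot.le ⟨u, rfl⟩)).trans (map_one _).symm))
  · obtain ⟨w, hw, hw1⟩ := W.bot_or_exists_ne_one.resolve_left hWbot
    obtain ⟨u, rfl⟩ := hWV hw
    rintro _ ⟨v, rfl⟩
    exact moduleHom_mem_of_normal hρ (fun hu => hw1 (by rw [hu, map_one])) hw v

theorem isInvertingSquare_range_moduleHom (hρ : IsModuleTriple ρ) (i : Fin 3) :
    IsInvertingSquare (moduleHom ρ i).range
      (SemidirectProduct.inr (centralInvolution i) : SemiProd ρ) where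
  isMinimalNormal := by
    have := hρ.nontrivial i
    exact isMinimalNormal_range_moduleHom (hρ i).1
  isMulCommutative := inferInstance
  commutator_mem g := by
    refine ⟨.ofAdd (-g.left.toAdd i - g.left.toAdd i), ?_⟩
    rw [commutatorElement_def, eq_mul_inv_iff_mul_eq, eq_mul_inv_iff_mul_eq]
    refine ext_semiProd (fun j => ?_) ?_
    · simp only [mul_left_apply, SemidirectProduct.left_inr, SemidirectProduct.right_inr, toAdd_one,
        Pi.zero_apply, map_zero, zero_add, add_zero, moduleHom_right, map_one,
        Module.End.one_apply]
      rcases eq_or_ne j i with rfl | hji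
      · rw [moduleHom_left_apply_self, toAdd_ofAdd, sub_add_cancel,
          map_centralInvolution_self hρ]
      · rw [moduleHom_left_apply_of_ne hji, zero_add, map_centralInvolution_of_ne hρ hji,
          Module.End.one_apply]
    · rw [SemidirectProduct.mul_right, SemidirectProduct.mul_right, SemidirectProduct.mul_right,
        moduleHom_right, one_mul, SemidirectProduct.right_inr]
      exact (centralInvolution_commute i g.right).symm.eq
  isSquare := (isSquare_centralInvolution i).map SemidirectProduct.inr
  sq_eq_one := by rw [← map_pow, centralInvolution_sq, map_one]
  exists_not_commute := by
    have := hρ.nontrivial i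
    obtain ⟨u, hu⟩ := exists_ne (0 : A i)
    refine ⟨moduleHom ρ i (.ofAdd u), ⟨_, rfl⟩, fun hcomm => hu ?_⟩
    have hneg : -u = u := Multiplicative.ofAdd.injective <| moduleHom_injective i <| by
      rw [← hcomm.mul_inv_cancel, mul_moduleHom_mul_inv, SemidirectProduct.right_inr, toAdd_ofAdd,
        map_centralInvolution_self hρ]
    have htwo : (2 : ZMod 3) • u = 0 := by
      rw [two_smul, ← eq_neg_iff_add_eq_zero, hneg]
    exact (smul_eq_zero.1 htwo).resolve_left (by decide)

theorem moduleHom_range_injective (hρ : IsModuleTriple ρ) :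
    Function.Injective fun i => (moduleHom ρ i).range := by
  intro i j (hij : (moduleHom ρ i).range = (moduleHom ρ j).range)
  by_contra hne
  obtain ⟨v, hv, hzv⟩ := (isInvertingSquare_range_moduleHom hρ i).exists_not_commute
  obtain ⟨u, rfl⟩ := hij ▸ hv
  refine hzv (mul_inv_eq_iff_eq_mul.1 ?_)
  rw [mul_moduleHom_mul_inv, SemidirectProduct.right_inr,
    map_centralInvolution_of_ne hρ (Ne.symm hne)]
  rfl

theorem iSup_range_moduleHom :
    ⨆ i, (moduleHom ρ i).range = (SemidirectProduct.inl : _ →* SemiProd ρ).range := by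
  refine le_antisymm (iSup_le fun i => ?_) ?_
  · rintro _ ⟨u, rfl⟩
    exact ⟨_, rfl⟩
  · rintro _ ⟨v, rfl⟩
    exact AddSubgroup.pi_mem_of_single_mem
      (H := Subgroup.toAddSubgroup' ((⨆ i, (moduleHom ρ i).range).comap SemidirectProduct.inl))
      v.toAdd fun i => Subgroup.mem_iSup_of_mem i ⟨.ofAdd (v.toAdd i), rfl⟩

theorem comap_rightHom_eq_sup {M H : Type*} [Group M] [Group H] {φ : H →* MulAut M}
    (S : Subgroup H) : S.comap (SemidirectProduct.rightHom (φ := φ)) =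
      SemidirectProduct.inl.range ⊔ S.map SemidirectProduct.inr := by
  rw [SemidirectProduct.range_inl_eq_ker_rightHom, sup_comm, ← Subgroup.comap_map_eq,
    Subgroup.map_map, SemidirectProduct.rightHom_comp_inr, Subgroup.map_id]

theorem isInvertingSystem_semiProd (hρ : IsModuleTriple ρ) :
    IsInvertingSystem (fun i => (moduleHom ρ i).range)
      (fun i => SemidirectProduct.inr (centralInvolution i))
      (fun j => (parity j).ker.comap SemidirectProduct.rightHom)
      (fun j => SemidirectProduct.inr (![x₁, x₂] j)) where
  injective := moduleHom_range_injective hρ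
  isInvertingSquare := isInvertingSquare_range_moduleHom hρ
  not_isCyclic i hcyc := by
    have : IsAddCyclic (A i) := isCyclic_multiplicative_iff.1
      ((MonoidHom.ofInjective (moduleHom_injective i)).isCyclic.2 hcyc)
    have hle := finrank_le_one_of_isAddCyclic (p := 3) (U := A i)
    rw [(hρ i).2.1] at hle
    contradiction
  index_eq_two j := by
    rw [Subgroup.index_comap_of_surjective _ SemidirectProduct.rightHom_surjective,
      index_ker_parity]
  iInf_eq := by
    rw [← Subgroup.comap_iInf, iInf_ker_parity, comap_rightHom_eq_sup, iSup_range_moduleHom,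
      MonoidHom.map_closure, ← Set.range_comp]
    rfl
  mem_iff i j := parity_generator_eq_one_iff i j
  commute j i := (centralInvolution_commute i _).symm.map SemidirectProduct.inr

theorem finite_semiProd (hρ : IsModuleTriple ρ) : Finite (SemiProd ρ) := by
  have := hρ.finite
  exact Finite.of_equiv _ SemidirectProduct.equivProd.symm

theorem isSolvable_X : Group.IsSolvable X :=
  have := (IsPGroup.of_card (p := 2) (n := 5) card_X).isNilpotent
  inferInstance

theorem isSolvable_semiProd (ρ : ∀ i, Representation (ZMod 3) X (A i)) :
    Group.IsSolvable (SemiProd ρ) :=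
  have := isSolvable_X
  Group.isSolvable_of_ker_le_range (SemidirectProduct.inl (φ := action ρ))
    (SemidirectProduct.rightHom (φ := action ρ)) SemidirectProduct.range_inl_eq_ker_rightHom.ge

theorem six_le_alpha_semiProd (hρ : IsModuleTriple ρ) : 6 ≤ alpha (SemiProd ρ) := by
  have := finite_semiProd hρ
  have h := isInvertingSystem_semiProd hρ
  simpa using two_mul_card_le_alpha h.injective h.isInvertingSquare

theorem Mindim_semiProd_le_five (hρ : IsModuleTriple ρ) : Mindim (SemiProd ρ) ≤ 5 := by
  have := finite_semiProd hρ
  simpa using (isInvertingSystem_semiProd hρ).Mindim_le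

theorem six_mul_le_alpha_pi (hρ : IsModuleTriple ρ) (k : ℕ) :
    6 * k ≤ alpha (Fin k → SemiProd ρ) := by
  have := finite_semiProd hρ
  have h := IsInvertingSystem.pi fun _ : Fin k => isInvertingSystem_semiProd hρ
  calc 6 * k = 2 * Nat.card (Σ _ : Fin k, Fin 3) := by simp; ring
    _ ≤ _ := two_mul_card_le_alpha h.injective h.isInvertingSquare

theorem Mindim_pi_le_five_mul (hρ : IsModuleTriple ρ) (k : ℕ) :
    Mindim (Fin k → SemiProd ρ) ≤ 5 * k := by
  have := finite_semiProd hρ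
  calc Mindim (Fin k → SemiProd ρ)
      ≤ Nat.card (Σ _ : Fin k, Fin 3) + Nat.card (Σ _ : Fin k, Fin 2) :=
        (IsInvertingSystem.pi fun _ => isInvertingSystem_semiProd hρ).Mindim_le
    _ = 5 * k := by simp; ring

end SemiProd

end SolubleExample

end

theorem mainTheorem12 :
    -- the group `X`: order, description as a quotient of the free group, normal subgroups
    (Nat.card SolubleExample.X = 32 ∧
      Subgroup.closure {SolubleExample.x₁, SolubleExample.x₂} = ⊤ ∧
      Nonempty (FreeGroup (Fin 2) ⧸ SolubleExample.freeKernel ≃* SolubleExample.X) ∧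
      ∀ i, ∃ _ : (SolubleExample.N i).Normal,
        Nonempty (SolubleExample.X ⧸ SolubleExample.N i ≃* SolubleExample.D8)) ∧
    -- modules as required exist
    (∃ ρ : ∀ _ : Fin 3, Representation (ZMod 3) SolubleExample.X (Fin 2 → ZMod 3),
      SolubleExample.IsModuleTriple ρ) ∧
    -- the bounds for `G` and for its direct powers, for every choice of the modules
    (∀ (A : Fin 3 → Type*) [∀ i, AddCommGroup (A i)] [∀ i, Module (ZMod 3) (A i)]
      (ρ : ∀ i, Representation (ZMod 3) SolubleExample.X (A i)),
      SolubleExample.IsModuleTriple ρ →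
        Finite (SolubleExample.SemiProd ρ) ∧
        Group.IsSolvable (SolubleExample.SemiProd ρ) ∧
        6 ≤ SolubleExample.alpha (SolubleExample.SemiProd ρ) ∧
        SolubleExample.Mindim (SolubleExample.SemiProd ρ) ≤ 5 ∧
        ∀ k : ℕ, 1 ≤ k →
          Group.IsSolvable (Fin k → SolubleExample.SemiProd ρ) ∧
          6 * k ≤ SolubleExample.alpha (Fin k → SolubleExample.SemiProd ρ) ∧
          SolubleExample.Mindim (Fin k → SolubleExample.SemiProd ρ) ≤ 5 * k ∧
          (k : ℤ) ≤ (SolubleExample.alpha (Fin k → SolubleExample.SemiProd ρ) : ℤ) -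
            (SolubleExample.Mindim (Fin k → SolubleExample.SemiProd ρ) : ℤ)) ∧
    -- the difference is unbounded on finite soluble groups
    (∀ n : ℕ, ∃ (H : Type) (_ : Group H), Finite H ∧ Group.IsSolvable H ∧
      (n : ℤ) ≤ (SolubleExample.alpha H : ℤ) - (SolubleExample.Mindim H : ℤ)) := by
  open SolubleExample in
  refine ⟨⟨card_X, closure_generators, nonempty_quotient_freeKernel, nonempty_quotient_N⟩,
    ⟨dihedralTriple, isModuleTriple_dihedralTriple⟩, fun A _ _ ρ hρ => ?_, fun n => ?_⟩
  · have := isSolvable_semiProd ρ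
    refine ⟨finite_semiProd hρ, this, six_le_alpha_semiProd hρ, Mindim_semiProd_le_five hρ,
      fun k _ => ?_⟩
    have hα := six_mul_le_alpha_pi hρ k
    have hMindim := Mindim_pi_le_five_mul hρ k
    exact ⟨isSolvable_pi, hα, hMindim, by omega⟩
  · have hρ := isModuleTriple_dihedralTriple
    have := finite_semiProd hρ
    have := isSolvable_semiProd dihedralTriple
    have hα := six_mul_le_alpha_pi hρ n
    have hMindim := Mindim_pi_le_five_mul hρ n
    exact ⟨Fin n → SemiProd dihedralTriple, inferInstance, inferInstance, isSolvable_pi, by omega⟩
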